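/- **Setting.** Let $A\in\mathbb R^{n\times n}$, $B\in\mathbb R^{n\times m}$, $N:=n+n_K$ with $n_K\ge 0$. Let $\mathcal S,\mathcal X,\mathcal D,\mathcal W,\mathcal V\subset\mathbb R^n$ and $\mathcal U\subset\mathbb R^m$ be convex polytopes containing $0$, with $\mathcal S\subseteq\mathcal X$. Assume $\mathcal V\subseteq\varepsilon_p\mathcal S$ and $-\mathcal V\subseteq\varepsilon_m\mathcal S$ with $\varepsilon_p,\varepsilon_m\in(0,1)$; that $\mathcal S$ contains a closed Euclidean ball of positive radius centred at $0$; and that $\mathcal S^+:=A\mathcal S\oplus\mathcal W\oplus\mathcal D\subseteq\mathcal X$. Put $\mathcal S_c:=\mathrm{conv}(\mathcal S\cup\mathcal S^+)$ and $\mathcal Z:=\mathcal W\times\mathcal V$. Let $\eta\in(0,1)$, $\varepsilon_p+\varepsilon_m<\varepsilon_s<1$, $\varepsilon_c>0$. Let $\mathbf 1$ be the all-ones vector, and let $H_{\mathcal S},H_{\mathcal X},H_{\mathcal U},H_{\mathcal Z}$ (with $n_{\mathcal S},n_{\mathcal X},n_{\mathcal U},n_{\mathcal Z}$ rows) and $\omega_1,\dots,\omega_{n_c}\in\mathbb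 R^n$ satisfy $\mathcal S=\{x:H_{\mathcal S}x\le\mathbf 1\}$, $\mathcal X=\{x:H_{\mathcal X}x\le\mathbf 1\}$, $\mathcal U=\{u:H_{\mathcal U}u\le\mathbf 1\}$, $\mathcal Z\subseteq\{z:-\mathbf 1\le H_{\mathcal Z}z\le\mathbf 1\}$ and $\mathcal S_c=\mathrm{conv}\{\omega_1,\dots,\omega_{n_c}\}$. For a controller $(A_K,B_K,C_K,D_K)$ of order $n_K$ put $$A_{CL}=\begin{bmatrix}A+BD_K&BC_K\\B_K&A_K\end{bmatrix},\quad B_{CL}=\begin{bmatrix}I&BD_K\\O&B_K\end{bmatrix},\quad C_{CL}=\begin{bmatrix}D_K&C_K\end{bmatrix},\quad D_{CL}=\begin{bmatrix}O&D_K\end{bmatrix}.$$ **The programs.** The indices run over $1\le j\le N$, $1\le q\le n_{\mathcal S}$, $1\le p\le n_{\mathcal X}$, $1\le\ell\le n_{\mathcal U}$, and $*$ stands for entries determined by symmetry. The variables of $\mathcal P^k(Q^k)$ are (superscripts $k$ omitted) $A_K,B_K,C_K,D_K$; $N\times N$ matrices $\widetilde H_I,\widetilde H_{Ii},H_O,H_{Oi},X_{I1j},X_{I2j},X_{O1j},X_{O2j},X_{\mathcal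 U\ell}$; and diagonal positive semidefinite matrices $D_{I1j},D_{O1j},D_{\mathcal Sq},D_{\mathcal Xp},D_{\mathcal U1\ell}$ (of size $N$) and $D_{I2j},D_{O2j},D_{\mathcal U2\ell}$ (of size $n_{\mathcal Z}$). Given slack matrices $Y_{I1j},Y_{I2j},Y_{O1j},Y_{O2j},Y_{\mathcal U\ell}\in\mathbb R^{N\times N}$, the constraints are, for all indices: 1. for $\bullet\in\{I,O\}$: $\begin{bmatrix}X_{\bullet2j}&O&A_{CL}^\top\\ *&H_{\mathcal Z}^\top D_{\bullet2j}H_{\mathcal Z}&B_{CL}^\top\\ *&*&X_{\bullet1j}\end{bmatrix}\succ O$; 2. $\begin{bmatrix}D&I\\ *&(HY)^\top+HY-Y^\top XY\end{bmatrix}\succ O$ for $(D,H,Y,X)$ equal to $(D_{I1j},\widetilde H_I,Y_{I2j},X_{I2j})$, to $(D_{O1j},H_O,Y_{O2j},X_{O2j})$ and to $(D_{\mathcal U1\ell},H_O,Y_{\mathcal U\ell},X_{\mathcal U\ell})$; 3. $\begin{bmatrix}Y^\top H+H^\top Y-Y^\top XY&e_j\\ *&2\theta-\mathbf 1^\top D_1\mathbf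 1-\mathbf 1^\top D_2\mathbf 1\end{bmatrix}\succ O$ for $(Y,H,X,\theta,D_1,D_2)$ equal to $(Y_{I1j},\widetilde H_{Ii},X_{I1j},\eta,D_{I1j},D_{I2j})$ and to $(Y_{O1j},H_{Oi},X_{O1j},1,D_{O1j},D_{O2j})$; 4. $\begin{bmatrix}D_{\mathcal Sq}&([H_{\mathcal S}\ O]\widetilde H_{Ii})^\top e_q\\ *&2(\varepsilon_s-\varepsilon_m-\varepsilon_p)-\mathbf 1^\top D_{\mathcal Sq}\mathbf 1\end{bmatrix}\succ O$ and $\begin{bmatrix}D_{\mathcal Xp}&([H_{\mathcal X}\ O]H_{Oi})^\top e_p\\ *&2-\mathbf 1^\top D_{\mathcal Xp}\mathbf 1\end{bmatrix}\succ O$; 5. $\begin{bmatrix}X_{\mathcal U\ell}&O&(H_{\mathcal U}C_{CL})^\top e_\ell\\ *&H_{\mathcal Z}^\top D_{\mathcal U2\ell}H_{\mathcal Z}&(H_{\mathcal U}D_{CL})^\top e_\ell\\ *&*&2-\mathbf 1^\top D_{\mathcal U1\ell}\mathbf 1-\mathbf 1^\top D_{\mathcal U2\ell}\mathbf 1\end{bmatrix}\succ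 O$; 6. $-\mathbf 1\le H_O\,[\omega_i^\top\ 0]^\top\le\mathbf 1$ for $1\le i\le n_c$; 7. $Q^k=O$. For $k=0$ the slack matrices $Y^0$ are chosen invertible, $Q^0:=O$, and the cost is $J^0:=\mathrm{tr}(M_0M_0^\top)$ with $M_0:=[\widetilde H_I\ \widetilde H_{Ii}\ H_O\ H_{Oi}]$. For $k\ge1$, with the computed solution of $\mathcal P^{k-1}(Q^{k-1})$ marked by the superscript $k-1$: $Y^k_{I1j}:=(X^{k-1}_{I1j})^{-1}\widetilde H^{k-1}_{Ii}$, $Y^k_{I2j}:=(X^{k-1}_{I2j})^{-1}(\widetilde H^{k-1}_{I})^\top$, $Y^k_{O1j}:=(X^{k-1}_{O1j})^{-1}H^{k-1}_{Oi}$, $Y^k_{O2j}:=(X^{k-1}_{O2j})^{-1}(H^{k-1}_{O})^\top$, $Y^k_{\mathcal U\ell}:=(X^{k-1}_{\mathcal U\ell})^{-1}(H^{k-1}_{O})^\top$; $Q^k:=[\widetilde H_I^k-\widetilde H_I^{k-1}\ \ H_O^k-H_O^{k-1}]$ for odd $k$ and $Q^k:=[\widetilde H_{Ii}^k-\widetilde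 H_{Ii}^{k-1}\ \ H_{Oi}^k-H_{Oi}^{k-1}]$ for even $k$; and the cost is $J^k:=g_k$, where for every $k\ge 0$ we put $g_k:=\mathrm{tr}(G^k(G^k)^\top)$ with $G^k:=[\widetilde H_I^k\widetilde H_{Ii}^k-I\ \ H_O^kH_{Oi}^k-I]$. The procedure solves $\mathcal P^0(Q^0),\mathcal P^1(Q^1),\dots$ in turn and stops at the first $k\ge1$ with $g_{k-1}-g_k<\varepsilon_c$. Let $\tau_k\ge0$. The computed solution of $\mathcal P^k(Q^k)$ is any feasible point whose cost exceeds that of no feasible point by more than $\tau_k$; $\tau_k=0$ means an exact optimizer. **Theorem.** Assume that $\mathcal P^0(Q^0)$ is feasible for the chosen invertible slack matrices $Y^0$. Then: (a) For every $k$ and all computed solutions of $\mathcal P^0(Q^0),\dots,\mathcal P^{k-1}(Q^{k-1})$, the program $\mathcal P^k(Q^k)$ is feasible, and if $\tau_k>0$ it has a solution that is optimal up to $\tau_k$. For every infinite sequence of computed solutions, the stopping test $g_{k-1}-g_k<\varepsilon_c$ holds for some $k\ge1$; moreover $g_{k+1}\le g_k+\tau_{k+1}$ for all $k\ge 0$ (so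 $g_k$ is non-increasing if all $\tau_k=0$), and if $\sum_k\tau_k<\infty$, then $g_k$ converges to some limit in $[0,\infty)$. (b) For every $k$ and all computed solutions of the preceding programs, the matrices $\widetilde H_I^k,\widetilde H_{Ii}^k,H_O^k,H_{Oi}^k$ of every feasible point (in particular of every optimizer) of $\mathcal P^k(Q^k)$ are invertible. (c) If, in (b), the feasible point satisfies $g_{k}=0$, then its controller together with $\widetilde\Omega_I:=\{\xi\in\mathbb R^N:-\mathbf 1\le\widetilde H_I^{k}\xi\le\mathbf 1\}$ and $\Omega_O:=\{\xi\in\mathbb R^N:-\mathbf 1\le H_O^{k}\xi\le\mathbf 1\}$ satisfies - C1) $A_{CL}\widetilde\Omega_I\oplus B_{CL}\mathcal Z\subseteq\eta\,\widetilde\Omega_I$; C2) $[I_n\ O]\,\widetilde\Omega_I\subseteq(\varepsilon_s-\varepsilon_p-\varepsilon_m)\mathcal S$; - O1) $\mathcal S_c\times\{0\}\subseteq\Omega_O$; O2) $A_{CL}\Omega_O\oplus B_{CL}\mathcal Z\subseteq\Omega_O$; O3) $[I_n\ O]\,\Omega_O\subseteq\mathcal X$; O4) $C_{CL}\Omega_O\oplus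 D_{CL}\mathcal Z\subseteq\mathcal U$. -/

import Mathlib

open Matrix Filter Topology
open scoped Pointwise

noncomputable section

namespace HandsOff

/-- Indices of the closed-loop state `ξ = (x, x_K)`. -/
abbrev CL (n nK : ℕ) : Type := Fin n ⊕ Fin nK

/-- Indices of the exogenous signal `z = (w, v)`. -/
abbrev EX (n : ℕ) : Type := Fin n ⊕ Fin n

/-- A (bounded) convex polytope: the convex hull of finitely many points. -/
def IsPolytope {ι : Type} (s : Set (ι → ℝ)) : Prop :=
  ∃ t : Set (ι → ℝ), t.Finite ∧ s = convexHull ℝ t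

/-- The input data of the synthesis procedure: the plant, its sets, the design scalars and the
half-space and vertex descriptions of the sets. -/
structure Data (n m nS nX nU nZ nc : ℕ) where
  A : Matrix (Fin n) (Fin n) ℝ
  B : Matrix (Fin n) (Fin m) ℝ
  /-- the hands-off region -/
  S : Set (Fin n → ℝ)
  /-- state constraints -/
  X : Set (Fin n → ℝ)
  /-- input constraints -/
  U : Set (Fin m → ℝ)
  /-- uncontrolled inputs -/
  D : Set (Fin n → ℝ)
  /-- process noise -/
  W : Set (Fin n → ℝ)
  /-- measurement noise -/
  V : Set (Fin n → ℝ)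
  εp : ℝ
  εm : ℝ
  εs : ℝ
  εc : ℝ
  η : ℝ
  HS : Matrix (Fin nS) (Fin n) ℝ
  HX : Matrix (Fin nX) (Fin n) ℝ
  HU : Matrix (Fin nU) (Fin m) ℝ
  HZ : Matrix (Fin nZ) (EX n) ℝ
  ω : Fin nc → (Fin n → ℝ)

section Sets

variable {n m nS nX nU nZ nc : ℕ} (d : Data n m nS nX nU nZ nc)

/-- `S⁺ = A S ⊕ W ⊕ D`. -/
def Data.Splus : Set (Fin n → ℝ) := (fun x => d.A *ᵥ x) '' d.S + d.W + d.D

/-- `S_c = conv(S, S⁺)`. -/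
def Data.Sc : Set (Fin n → ℝ) := convexHull ℝ (d.S ∪ d.Splus)

/-- `Z = W × V`. -/
def Data.Z : Set (EX n → ℝ) := {z | z ∘ Sum.inl ∈ d.W ∧ z ∘ Sum.inr ∈ d.V}

/-- The standing assumptions on the input data. -/
structure Data.Admissible : Prop where
  polyS : IsPolytope d.S
  polyX : IsPolytope d.X
  polyU : IsPolytope d.U
  polyD : IsPolytope d.D
  polyW : IsPolytope d.W
  polyV : IsPolytope d.V
  zeroS : (0 : Fin n → ℝ) ∈ d.S
  zeroX : (0 : Fin n → ℝ) ∈ d.X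
  zeroU : (0 : Fin m → ℝ) ∈ d.U
  zeroD : (0 : Fin n → ℝ) ∈ d.D
  zeroW : (0 : Fin n → ℝ) ∈ d.W
  zeroV : (0 : Fin n → ℝ) ∈ d.V
  subSX : d.S ⊆ d.X
  εp_mem : d.εp ∈ Set.Ioo (0 : ℝ) 1
  εm_mem : d.εm ∈ Set.Ioo (0 : ℝ) 1
  subV : d.V ⊆ d.εp • d.S
  subNegV : -d.V ⊆ d.εm • d.S
  ball : ∃ δ : ℝ, 0 < δ ∧ {r : Fin n → ℝ | ‖WithLp.toLp 2 r‖ ≤ δ} ⊆ d.S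
  subSplus : d.Splus ⊆ d.X
  η_mem : d.η ∈ Set.Ioo (0 : ℝ) 1
  εs_gt : d.εp + d.εm < d.εs
  εs_lt : d.εs < 1
  εc_pos : 0 < d.εc
  repS : d.S = {x | d.HS *ᵥ x ≤ 1}
  repSc : d.Sc = {x | ∃ α : Fin nc → ℝ, (∀ i, 0 ≤ α i) ∧ 1 = ∑ i, α i ∧ x = ∑ i, α i • d.ω i}
  repX : d.X = {x | d.HX *ᵥ x ≤ 1}
  repU : d.U = {u | d.HU *ᵥ u ≤ 1}
  repZ : d.Z ⊆ {z | -1 ≤ d.HZ *ᵥ z ∧ d.HZ *ᵥ z ≤ 1}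

end Sets

/-- The decision variables of one semidefinite program. -/
structure Vars (n m nK nS nX nU nZ : ℕ) where
  AK : Matrix (Fin nK) (Fin nK) ℝ
  BK : Matrix (Fin nK) (Fin n) ℝ
  CK : Matrix (Fin m) (Fin nK) ℝ
  DK : Matrix (Fin m) (Fin n) ℝ
  HI : Matrix (CL n nK) (CL n nK) ℝ
  HIi : Matrix (CL n nK) (CL n nK) ℝ
  HO : Matrix (CL n nK) (CL n nK) ℝ
  HOi : Matrix (CL n nK) (CL n nK) ℝ
  XI1 : CL n nK → Matrix (CL n nK) (CL n nK) ℝ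
  XI2 : CL n nK → Matrix (CL n nK) (CL n nK) ℝ
  XO1 : CL n nK → Matrix (CL n nK) (CL n nK) ℝ
  XO2 : CL n nK → Matrix (CL n nK) (CL n nK) ℝ
  XU : Fin nU → Matrix (CL n nK) (CL n nK) ℝ
  DI1 : CL n nK → Matrix (CL n nK) (CL n nK) ℝ
  DI2 : CL n nK → Matrix (Fin nZ) (Fin nZ) ℝ
  DO1 : CL n nK → Matrix (CL n nK) (CL n nK) ℝ
  DO2 : CL n nK → Matrix (Fin nZ) (Fin nZ) ℝ
  DS : Fin nS → Matrix (CL n nK) (CL n nK) ℝ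
  DX : Fin nX → Matrix (CL n nK) (CL n nK) ℝ
  DU1 : Fin nU → Matrix (CL n nK) (CL n nK) ℝ
  DU2 : Fin nU → Matrix (Fin nZ) (Fin nZ) ℝ

/-- The slack matrices `Y`, which are fixed parameters in each program. -/
structure Slack (n nK nU : ℕ) where
  YI1 : CL n nK → Matrix (CL n nK) (CL n nK) ℝ
  YI2 : CL n nK → Matrix (CL n nK) (CL n nK) ℝ
  YO1 : CL n nK → Matrix (CL n nK) (CL n nK) ℝ
  YO2 : CL n nK → Matrix (CL n nK) (CL n nK) ℝ
  YU : Fin nU → Matrix (CL n nK) (CL n nK) ℝ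

/-- All slack matrices are invertible. -/
def Slack.Invertible {n nK nU : ℕ} (Y : Slack n nK nU) : Prop :=
  (∀ j, IsUnit (Y.YI1 j) ∧ IsUnit (Y.YI2 j) ∧ IsUnit (Y.YO1 j) ∧ IsUnit (Y.YO2 j)) ∧
    ∀ l, IsUnit (Y.YU l)

/-- The symmetric matrix `[M b; bᵀ r]` with a scalar lower right block. -/
def bordered {ι : Type} (M : Matrix ι ι ℝ) (b : ι → ℝ) (r : ℝ) :
    Matrix (ι ⊕ Unit) (ι ⊕ Unit) ℝ :=
  fromBlocks M (replicateCol Unit b) (replicateRow Unit b) (Matrix.of fun _ _ => r)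

/-- The sum `1ᵀ M 1`. -/
def ones {ι : Type} [Fintype ι] (M : Matrix ι ι ℝ) : ℝ := 1 ⬝ᵥ (M *ᵥ 1)

section Programs

variable {n m nK nS nX nU nZ nc : ℕ}

/-- `A_CL`. -/
def Acl (d : Data n m nS nX nU nZ nc) (v : Vars n m nK nS nX nU nZ) :
    Matrix (CL n nK) (CL n nK) ℝ :=
  fromBlocks (d.A + d.B * v.DK) (d.B * v.CK) v.BK v.AK

/-- `B_CL`. -/
def Bcl (d : Data n m nS nX nU nZ nc) (v : Vars n m nK nS nX nU nZ) :
    Matrix (CL n nK) (EX n) ℝ :=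
  fromBlocks 1 (d.B * v.DK) 0 v.BK

/-- `C_CL`. -/
def Ccl (v : Vars n m nK nS nX nU nZ) : Matrix (Fin m) (CL n nK) ℝ := fromCols v.DK v.CK

/-- `D_CL`. -/
def Dcl (v : Vars n m nK nS nX nU nZ) : Matrix (Fin m) (EX n) ℝ := fromCols 0 v.DK

/-- The matrix `[X₂ O Aᵀ; * HᵀDH Bᵀ; * * X₁]`. -/
def dynBlock (H : Matrix (Fin nZ) (EX n) ℝ) (A : Matrix (CL n nK) (CL n nK) ℝ)
    (B : Matrix (CL n nK) (EX n) ℝ) (X2 X1 : Matrix (CL n nK) (CL n nK) ℝ)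
    (D : Matrix (Fin nZ) (Fin nZ) ℝ) :
    Matrix ((CL n nK ⊕ EX n) ⊕ CL n nK) ((CL n nK ⊕ EX n) ⊕ CL n nK) ℝ :=
  fromBlocks (fromBlocks X2 0 0 (Hᵀ * D * H)) (fromRows Aᵀ Bᵀ) (fromCols A B) X1

/-- The matrix `[D I; * (HY)ᵀ + HY - YᵀXY]`. -/
def slackBlock (D H Y X : Matrix (CL n nK) (CL n nK) ℝ) :
    Matrix (CL n nK ⊕ CL n nK) (CL n nK ⊕ CL n nK) ℝ :=
  fromBlocks D 1 1 ((H * Y)ᵀ + H * Y - Yᵀ * X * Y)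

/-- The constraints of a program with slack matrices `Y`, except for the one on `Q`. -/
structure Constraints (d : Data n m nS nX nU nZ nc) (Y : Slack n nK nU)
    (v : Vars n m nK nS nX nU nZ) : Prop where
  diagI1 : ∀ j, (v.DI1 j).PosSemidef ∧ (v.DI1 j).IsDiag
  diagI2 : ∀ j, (v.DI2 j).PosSemidef ∧ (v.DI2 j).IsDiag
  diagO1 : ∀ j, (v.DO1 j).PosSemidef ∧ (v.DO1 j).IsDiag
  diagO2 : ∀ j, (v.DO2 j).PosSemidef ∧ (v.DO2 j).IsDiag
  diagS : ∀ q, (v.DS q).PosSemidef ∧ (v.DS q).IsDiag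
  diagX : ∀ p, (v.DX p).PosSemidef ∧ (v.DX p).IsDiag
  diagU1 : ∀ l, (v.DU1 l).PosSemidef ∧ (v.DU1 l).IsDiag
  diagU2 : ∀ l, (v.DU2 l).PosSemidef ∧ (v.DU2 l).IsDiag
  dynI : ∀ j, (dynBlock d.HZ (Acl d v) (Bcl d v) (v.XI2 j) (v.XI1 j) (v.DI2 j)).PosDef
  dynO : ∀ j, (dynBlock d.HZ (Acl d v) (Bcl d v) (v.XO2 j) (v.XO1 j) (v.DO2 j)).PosDef
  slackI : ∀ j, (slackBlock (v.DI1 j) v.HI (Y.YI2 j) (v.XI2 j)).PosDef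
  slackO : ∀ j, (slackBlock (v.DO1 j) v.HO (Y.YO2 j) (v.XO2 j)).PosDef
  rowI : ∀ j, (bordered
    ((Y.YI1 j)ᵀ * v.HIi + v.HIiᵀ * Y.YI1 j - (Y.YI1 j)ᵀ * v.XI1 j * Y.YI1 j)
    (Pi.single j 1) (2 * d.η - ones (v.DI1 j) - ones (v.DI2 j))).PosDef
  rowO : ∀ j, (bordered
    ((Y.YO1 j)ᵀ * v.HOi + v.HOiᵀ * Y.YO1 j - (Y.YO1 j)ᵀ * v.XO1 j * Y.YO1 j)
    (Pi.single j 1) (2 - ones (v.DO1 j) - ones (v.DO2 j))).PosDef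
  inclS : ∀ q, (bordered (v.DS q)
    ((fromCols d.HS (0 : Matrix (Fin nS) (Fin nK) ℝ) * v.HIi)ᵀ *ᵥ Pi.single q 1)
    (2 * (d.εs - d.εm - d.εp) - ones (v.DS q))).PosDef
  inclX : ∀ p, (bordered (v.DX p)
    ((fromCols d.HX (0 : Matrix (Fin nX) (Fin nK) ℝ) * v.HOi)ᵀ *ᵥ Pi.single p 1)
    (2 - ones (v.DX p))).PosDef
  inclU : ∀ l, (bordered (fromBlocks (v.XU l) 0 0 (d.HZᵀ * v.DU2 l * d.HZ))
    (Sum.elim ((d.HU * Ccl v)ᵀ *ᵥ Pi.single l 1) ((d.HU * Dcl v)ᵀ *ᵥ Pi.single l 1))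
    (2 - ones (v.DU1 l) - ones (v.DU2 l))).PosDef
  slackU : ∀ l, (slackBlock (v.DU1 l) v.HO (Y.YU l) (v.XU l)).PosDef
  vertices : ∀ i, -1 ≤ v.HO *ᵥ Sum.elim (d.ω i) 0 ∧ v.HO *ᵥ Sum.elim (d.ω i) 0 ≤ 1

/-- The slack matrices obtained from the solution `v` of the preceding program. -/
def nextSlack (v : Vars n m nK nS nX nU nZ) : Slack n nK nU where
  YI1 j := (v.XI1 j)⁻¹ * v.HIi
  YI2 j := (v.XI2 j)⁻¹ * v.HIᵀ
  YO1 j := (v.XO1 j)⁻¹ * v.HOi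
  YO2 j := (v.XO2 j)⁻¹ * v.HOᵀ
  YU l := (v.XU l)⁻¹ * v.HOᵀ

/-- The slack matrices `Y^k`, where `sol i` is the computed solution of the `i`-th program. -/
def slackAt (Y0 : Slack n nK nU) (sol : ℕ → Vars n m nK nS nX nU nZ) : ℕ → Slack n nK nU
  | 0 => Y0
  | k + 1 => nextSlack (sol k)

/-- The matrix `Q^k` as a function of the decision variables `v` of the `k`-th program. -/
def lockAt (sol : ℕ → Vars n m nK nS nX nU nZ) (v : Vars n m nK nS nX nU nZ) :
    ℕ → Matrix (CL n nK) (CL n nK ⊕ CL n nK) ℝ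
  | 0 => 0
  | k + 1 =>
    if 0 < (k + 1) % 2 then fromCols (v.HI - (sol k).HI) (v.HO - (sol k).HO)
    else fromCols (v.HIi - (sol k).HIi) (v.HOi - (sol k).HOi)

/-- `v` is feasible for the program `P^k(Q^k)`. The program depends on the solutions computed
before only through `sol (k - 1)`, and not at all on `sol` if `k = 0`. -/
def Feasible (d : Data n m nS nX nU nZ nc) (Y0 : Slack n nK nU)
    (sol : ℕ → Vars n m nK nS nX nU nZ) (k : ℕ) (v : Vars n m nK nS nX nU nZ) : Prop :=
  Constraints d (slackAt Y0 sol k) v ∧ lockAt sol v k = 0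

/-- The matrix `G`. -/
def G (v : Vars n m nK nS nX nU nZ) : Matrix (CL n nK) (CL n nK ⊕ CL n nK) ℝ :=
  fromCols (v.HI * v.HIi - 1) (v.HO * v.HOi - 1)

/-- The value `tr(G Gᵀ)`. -/
def gap (v : Vars n m nK nS nX nU nZ) : ℝ := (G v * (G v)ᵀ).trace

/-- The matrix `M₀`. -/
def M0 (v : Vars n m nK nS nX nU nZ) :
    Matrix (CL n nK) (((CL n nK ⊕ CL n nK) ⊕ CL n nK) ⊕ CL n nK) ℝ :=
  fromCols (fromCols (fromCols v.HI v.HIi) v.HO) v.HOi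

/-- The cost function `J^k`. -/
def cost (k : ℕ) (v : Vars n m nK nS nX nU nZ) : ℝ :=
  if k = 0 then (M0 v * (M0 v)ᵀ).trace else gap v

/-- `v` is a solution of `P^k(Q^k)` that is optimal up to the tolerance `t`; for `t = 0` this
says that `v` is an optimizer. -/
def IsOptimizerUpTo (d : Data n m nS nX nU nZ nc) (Y0 : Slack n nK nU)
    (sol : ℕ → Vars n m nK nS nX nU nZ) (k : ℕ) (t : ℝ) (v : Vars n m nK nS nX nU nZ) : Prop :=
  Feasible d Y0 sol k v ∧ ∀ w, Feasible d Y0 sol k w → cost k v ≤ cost k w + t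

/-- The set `{ξ : -1 ≤ H ξ ≤ 1}`. -/
def box (H : Matrix (CL n nK) (CL n nK) ℝ) : Set (CL n nK → ℝ) :=
  {ξ | -1 ≤ H *ᵥ ξ ∧ H *ᵥ ξ ≤ 1}

/-- Conditions C1) and C2) for the set `Ω` and the controller contained in `v`. -/
structure InnerConditions (d : Data n m nS nX nU nZ nc) (v : Vars n m nK nS nX nU nZ)
    (Ω : Set (CL n nK → ℝ)) : Prop where
  C1 : (fun ξ => Acl d v *ᵥ ξ) '' Ω + (fun z => Bcl d v *ᵥ z) '' d.Z ⊆ d.η • Ω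
  C2 : (fun ξ => ξ ∘ Sum.inl) '' Ω ⊆ (d.εs - d.εp - d.εm) • d.S

/-- Conditions O1) to O4) for the set `Ω` and the controller contained in `v`. -/
structure OuterConditions (d : Data n m nS nX nU nZ nc) (v : Vars n m nK nS nX nU nZ)
    (Ω : Set (CL n nK → ℝ)) : Prop where
  O1 : {ξ : CL n nK → ℝ | ξ ∘ Sum.inl ∈ d.Sc ∧ ξ ∘ Sum.inr = 0} ⊆ Ω
  O2 : (fun ξ => Acl d v *ᵥ ξ) '' Ω + (fun z => Bcl d v *ᵥ z) '' d.Z ⊆ Ω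
  O3 : (fun ξ => ξ ∘ Sum.inl) '' Ω ⊆ d.X
  O4 : (fun ξ => Ccl v *ᵥ ξ) '' Ω + (fun z => Dcl v *ᵥ z) '' d.Z ⊆ d.U

end Programs

end HandsOff

end

/-! Everything rests on completing the square. For positive definite `X`, the form `YᵀH + HᵀY -
YᵀXY` is bounded, for every `Y`, by that of `HᵀX⁻¹H`, with equality at `Y = X⁻¹H` (`rowTerm_le`,
`rowTerm_le_rowTerm_inv_mul`). Equality shows that updating the slack matrices from a feasible point
only relaxes the constraints there. The old point therefore stays feasible, and since it also
satisfies the new lock `Q = 0`, near-optimality gives `g (k+1) ≤ g k + τ (k+1)`. The bound shows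
that the form cannot be positive on the kernel of `H`, so the four matrices are invertible. If `g =
0`, then `HI * HIi = 1` and `HO * HOi = 1`, and the bound eliminates the slack matrices: the
constraints become `X₂ ≤ HᵀD₁H` and `hⱼᵀX₁hⱼ ≤ 2θ - 1ᵀD₁1 - 1ᵀD₂1` for the rows `hⱼ` of `H`.
Evaluating the dynamics block at `(ξ, z, ±hⱼ)` then gives the invariance conditions (`abs_row_le`);
the inclusions follow from similar test vectors. -/

namespace HandsOff

/-! ### Quadratic forms, completion of the square and bordered matrices. -/

section QuadraticForms

variable {ι κ : Type}

lemma transpose_eq_of_posDef {M : Matrix ι ι ℝ} (hM : M.PosDef) : Mᵀ = M := by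
  simpa using hM.isHermitian.eq

lemma transpose_bordered (M : Matrix ι ι ℝ) (b : ι → ℝ) (r : ℝ) (hM : Mᵀ = M) :
    (bordered M b r)ᵀ = bordered M b r := by
  simp only [bordered, fromBlocks_transpose, hM, transpose_replicateCol, transpose_replicateRow]
  rfl

lemma exists_eq_elim_const (x : ι ⊕ Unit → ℝ) :
    ∃ w s, x = Sum.elim w (fun _ ↦ s) :=
  ⟨x ∘ Sum.inl, x (Sum.inr ()), by ext (i | i) <;> rfl⟩

lemma posDef_of_bordered {M : Matrix ι ι ℝ} {b : ι → ℝ} {r : ℝ} (h : (bordered M b r).PosDef) :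
    M.PosDef :=
  h.submatrix (e := Sum.inl) Sum.inl_injective

variable [Fintype ι] [Fintype κ]

lemma quadForm_pos {M : Matrix ι ι ℝ} (hM : M.PosDef) {x : ι → ℝ} (hx : x ≠ 0) :
    0 < x ⬝ᵥ (M *ᵥ x) := by
  simpa using hM.dotProduct_mulVec_pos hx

lemma quadForm_nonneg {M : Matrix ι ι ℝ} (hM : M.PosDef) (x : ι → ℝ) :
    0 ≤ x ⬝ᵥ (M *ᵥ x) := by
  simpa using hM.posSemidef.dotProduct_mulVec_nonneg x

lemma posDef_of_quadForm_pos {M : Matrix ι ι ℝ} (hT : Mᵀ = M)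
    (h : ∀ x : ι → ℝ, x ≠ 0 → 0 < x ⬝ᵥ (M *ᵥ x)) : M.PosDef :=
  .of_dotProduct_mulVec_pos (by simpa [IsHermitian] using hT) fun x hx ↦ by simpa using h x hx

lemma mulVec_dotProduct (M : Matrix ι κ ℝ) (x : κ → ℝ) (y : ι → ℝ) :
    (M *ᵥ x) ⬝ᵥ y = x ⬝ᵥ (Mᵀ *ᵥ y) := by
  rw [dotProduct_comm, dotProduct_mulVec, ← mulVec_transpose, dotProduct_comm]

/-- The concave function `a ↦ 2 aᵀXc - aᵀXa` is maximal at `a = c`. -/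
lemma two_mul_dotProduct_sub_le {X : Matrix ι ι ℝ} (hX : X.PosDef) (a c : ι → ℝ) :
    2 * (a ⬝ᵥ (X *ᵥ c)) - a ⬝ᵥ (X *ᵥ a) ≤ c ⬝ᵥ (X *ᵥ c) := by
  have h := quadForm_nonneg hX (a - c)
  have hs : c ⬝ᵥ (X *ᵥ a) = a ⬝ᵥ (X *ᵥ c) := by
    rw [dotProduct_comm, mulVec_dotProduct, transpose_eq_of_posDef hX]
  simp only [mulVec_sub, sub_dotProduct, dotProduct_sub, hs] at h
  linarith

lemma isUnit_of_mulVec_ne_zero [DecidableEq ι] {M : Matrix ι ι ℝ}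
    (h : ∀ x, x ≠ 0 → M *ᵥ x ≠ 0) : IsUnit M := by
  rw [← mulVec_injective_iff_isUnit]
  intro x y hxy
  by_contra hne
  exact h (x - y) (sub_ne_zero.2 hne) (by rw [mulVec_sub, sub_eq_zero]; exact hxy)

lemma quadForm_bordered (M : Matrix ι ι ℝ) (b : ι → ℝ) (r : ℝ) (w : ι → ℝ) (s : ℝ) :
    Sum.elim w (fun _ ↦ s) ⬝ᵥ (bordered M b r *ᵥ Sum.elim w fun _ ↦ s) =
      w ⬝ᵥ (M *ᵥ w) + 2 * s * (w ⬝ᵥ b) + s ^ 2 * r := by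
  have h1 : replicateCol Unit b *ᵥ (fun _ ↦ s) = s • b := by
    ext i; simp [mulVec, dotProduct, mul_comm]
  have h2 : replicateRow Unit b *ᵥ w = fun _ ↦ w ⬝ᵥ b := by
    ext i; simp [mulVec, dotProduct, mul_comm]
  simp only [bordered, fromBlocks_mulVec, Sum.elim_comp_inl, Sum.elim_comp_inr,
    sumElim_dotProduct_sumElim, h1, h2, dotProduct_add, dotProduct_smul, smul_eq_mul]
  simp [mulVec, dotProduct]
  ring

/-- The diagonal block in the constraints on the rows of the inverse matrices. -/
lemma quadForm_rowTerm (Y H X : Matrix ι ι ℝ) (w : ι → ℝ) :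
    w ⬝ᵥ ((Yᵀ * H + Hᵀ * Y - Yᵀ * X * Y) *ᵥ w) =
      2 * ((Y *ᵥ w) ⬝ᵥ (H *ᵥ w)) - (Y *ᵥ w) ⬝ᵥ (X *ᵥ (Y *ᵥ w)) := by
  have h : w ⬝ᵥ (Hᵀ *ᵥ (Y *ᵥ w)) = (Y *ᵥ w) ⬝ᵥ (H *ᵥ w) := by
    rw [← mulVec_dotProduct, dotProduct_comm]
  simp only [sub_mulVec, add_mulVec, ← mulVec_mulVec, dotProduct_add, dotProduct_sub, h,
    ← mulVec_dotProduct]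
  ring

/-- The left side is `2 aᵀXc - aᵀXa` with `a = Yw`. Giving `c` by an equation instead of as `X⁻¹Hw`
allows choices such as `c = 0` or a row of `H⁻¹`. -/
lemma rowTerm_le {X : Matrix ι ι ℝ} (hX : X.PosDef) (Y H : Matrix ι ι ℝ) {w c : ι → ℝ}
    (hc : X *ᵥ c = H *ᵥ w) :
    w ⬝ᵥ ((Yᵀ * H + Hᵀ * Y - Yᵀ * X * Y) *ᵥ w) ≤ c ⬝ᵥ (X *ᵥ c) := by
  rw [quadForm_rowTerm, ← hc]
  exact two_mul_dotProduct_sub_le hX _ _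

/-- On a kernel vector of `H`, `c = 0` is admissible in `rowTerm_le`, so the form would be at most
`0`. -/
lemma isUnit_of_rowTerm_posDef [DecidableEq ι] {X Y H : Matrix ι ι ℝ} (hX : X.PosDef)
    (h : (Yᵀ * H + Hᵀ * Y - Yᵀ * X * Y).PosDef) : IsUnit H := by
  refine isUnit_of_mulVec_ne_zero fun x hx h0 ↦ ?_
  have h1 := quadForm_pos h hx
  have h2 := rowTerm_le hX Y H (w := x) (c := 0) (by simp [h0])
  simp at h2
  linarith

lemma mulVec_inv_mul_mulVec [DecidableEq ι] {X : Matrix ι ι ℝ} (hX : X.PosDef)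
    (H : Matrix ι ι ℝ) (w : ι → ℝ) : X *ᵥ ((X⁻¹ * H) *ᵥ w) = H *ᵥ w := by
  rw [mulVec_mulVec, mul_nonsing_inv_cancel_left _ _ ((isUnit_iff_isUnit_det _).1 hX.isUnit)]

/-- The choice `Y = X⁻¹H` makes `Yw` equal to the maximizer `c`, so it attains the bound of
`rowTerm_le` for all `w` at once. -/
lemma rowTerm_le_rowTerm_inv_mul [DecidableEq ι] {X : Matrix ι ι ℝ} (hX : X.PosDef)
    (Y H : Matrix ι ι ℝ) (w : ι → ℝ) :
    w ⬝ᵥ ((Yᵀ * H + Hᵀ * Y - Yᵀ * X * Y) *ᵥ w) ≤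
      w ⬝ᵥ (((X⁻¹ * H)ᵀ * H + Hᵀ * (X⁻¹ * H) - (X⁻¹ * H)ᵀ * X * (X⁻¹ * H)) *ᵥ w) := by
  refine (rowTerm_le hX Y H (mulVec_inv_mul_mulVec hX H w)).trans_eq ?_
  rw [quadForm_rowTerm, mulVec_inv_mul_mulVec hX]
  ring

lemma transpose_rowTerm {X : Matrix ι ι ℝ} (hX : X.PosDef) (Y H : Matrix ι ι ℝ) :
    (Yᵀ * H + Hᵀ * Y - Yᵀ * X * Y)ᵀ = Yᵀ * H + Hᵀ * Y - Yᵀ * X * Y := by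
  simp only [transpose_sub, transpose_add, transpose_mul, transpose_transpose,
    transpose_eq_of_posDef hX, Matrix.mul_assoc]
  abel

lemma bordered_rowTerm_inv_mul_posDef [DecidableEq ι] {X Y H : Matrix ι ι ℝ} {b : ι → ℝ} {r : ℝ}
    (hX : X.PosDef) (h : (bordered (Yᵀ * H + Hᵀ * Y - Yᵀ * X * Y) b r).PosDef) :
    (bordered ((X⁻¹ * H)ᵀ * H + Hᵀ * (X⁻¹ * H) - (X⁻¹ * H)ᵀ * X * (X⁻¹ * H)) b r).PosDef := by
  refine posDef_of_quadForm_pos (transpose_bordered _ _ _ (transpose_rowTerm hX _ _))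
    fun x hx ↦ ?_
  have h1 := quadForm_pos h hx
  obtain ⟨w, s, rfl⟩ := exists_eq_elim_const x
  rw [quadForm_bordered] at h1 ⊢
  have := rowTerm_le_rowTerm_inv_mul hX Y H w
  linarith

/-- If `HHi = 1`, the row constraint bounds the form of `X` at the `j`-th row of `H`. -/
lemma row_quadForm_le [DecidableEq ι] {X Y H Hi : Matrix ι ι ℝ} {j : ι} {r : ℝ} (hX : X.PosDef)
    (hH : H * Hi = 1) (h : (bordered (Yᵀ * Hi + Hiᵀ * Y - Yᵀ * X * Y) (Pi.single j 1) r).PosDef) :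
    H j ⬝ᵥ (X *ᵥ H j) ≤ r := by
  have hc : X *ᵥ H j = Hi *ᵥ (H *ᵥ (X *ᵥ H j)) := by
    rw [mulVec_mulVec, mul_eq_one_comm.1 hH, one_mulVec]
  -- With `q` the form of `X` at `H j`, this vector has `j`-th entry `q` and is mapped by `Hi` to `X
  -- *ᵥ H j`. The block contributes at most `q`, so `0 ≤ q - 2q + r`.
  have h1 := quadForm_nonneg h (Sum.elim (H *ᵥ (X *ᵥ H j)) fun _ ↦ -1)
  have h2 := rowTerm_le hX Y Hi hc
  have h3 : (H *ᵥ (X *ᵥ H j)) ⬝ᵥ Pi.single j 1 = H j ⬝ᵥ (X *ᵥ H j) := by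
    rw [dotProduct_single, mul_one]; rfl
  rw [quadForm_bordered, h3] at h1
  linarith

/-- On the box, the form of a nonnegative diagonal matrix is at most the sum of its entries. -/
lemma quadForm_le_ones [DecidableEq ι] {D : Matrix ι ι ℝ} (hD : D.PosSemidef ∧ D.IsDiag)
    {y : ι → ℝ} (hy : -1 ≤ y ∧ y ≤ 1) : y ⬝ᵥ (D *ᵥ y) ≤ ones D := by
  have hdiag := hD.2.diagonal_diag
  rw [ones, ← hdiag]
  simp only [dotProduct, mulVec_diagonal]
  refine Finset.sum_le_sum fun i _ ↦ ?_
  have h0 : 0 ≤ D.diag i := hD.1.diag_nonneg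
  have h1 := hy.1 i
  have h2 := hy.2 i
  simp only [Pi.neg_apply, Pi.one_apply] at h1 h2 ⊢
  nlinarith [mul_nonneg h0 (mul_nonneg (by linarith : 0 ≤ 1 + y i) (by linarith : 0 ≤ 1 - y i))]

/-- The test vector `(y, -1)` gives `2 yᵀb ≤ yᵀDy + 2r - 1ᵀD1`, and `yᵀDy ≤ 1ᵀD1` on the box. -/
lemma dotProduct_le_of_bordered_posDef [DecidableEq ι] {D : Matrix ι ι ℝ} {b y : ι → ℝ} {r : ℝ}
    (hD : D.PosSemidef ∧ D.IsDiag) (h : (bordered D b (2 * r - ones D)).PosDef)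
    (hy : -1 ≤ y ∧ y ≤ 1) : y ⬝ᵥ b ≤ r := by
  have h1 := quadForm_nonneg h (Sum.elim y fun _ ↦ -1)
  rw [quadForm_bordered] at h1
  have := quadForm_le_ones hD hy
  linarith

end QuadraticForms

/-! ### The block matrices of the programs and the bounds they imply on boxes. -/

section Blocks

variable {n nK nZ : ℕ}

/-- The lower block is written with `Hᵀ` in the role of `H`, so that the `rowTerm` lemmas apply to
it. -/
lemma quadForm_slackBlock (D H Y X : Matrix (CL n nK) (CL n nK) ℝ) (u w : CL n nK → ℝ) :
    Sum.elim u w ⬝ᵥ (slackBlock D H Y X *ᵥ Sum.elim u w) =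
      u ⬝ᵥ (D *ᵥ u) + 2 * (u ⬝ᵥ w) + w ⬝ᵥ ((Yᵀ * Hᵀ + Hᵀᵀ * Y - Yᵀ * X * Y) *ᵥ w) := by
  simp only [slackBlock, fromBlocks_mulVec, Sum.elim_comp_inl, Sum.elim_comp_inr,
    sumElim_dotProduct_sumElim, one_mulVec, dotProduct_add, transpose_mul, transpose_transpose]
  rw [dotProduct_comm w u]
  ring

lemma posDef_of_slackBlock {D H Y X : Matrix (CL n nK) (CL n nK) ℝ}
    (h : (slackBlock D H Y X).PosDef) :
    D.PosDef ∧ (Yᵀ * Hᵀ + Hᵀᵀ * Y - Yᵀ * X * Y).PosDef := by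
  refine ⟨h.submatrix (e := Sum.inl) Sum.inl_injective, ?_⟩
  have := h.submatrix (e := Sum.inr) Sum.inr_injective
  rw [← transpose_mul, transpose_transpose]
  exact this

lemma isUnit_of_slackBlock_posDef {D H Y X : Matrix (CL n nK) (CL n nK) ℝ} (hX : X.PosDef)
    (h : (slackBlock D H Y X).PosDef) : IsUnit H :=
  (isUnit_transpose H).1 (isUnit_of_rowTerm_posDef hX (posDef_of_slackBlock h).2)

lemma slackBlock_inv_mul_posDef {D H Y X : Matrix (CL n nK) (CL n nK) ℝ} (hX : X.PosDef)
    (h : (slackBlock D H Y X).PosDef) : (slackBlock D H (X⁻¹ * Hᵀ) X).PosDef := by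
  have hD := transpose_eq_of_posDef (posDef_of_slackBlock h).1
  have hM := transpose_rowTerm hX (X⁻¹ * Hᵀ) Hᵀ
  rw [← transpose_mul, transpose_transpose] at hM
  refine posDef_of_quadForm_pos ?_ fun x hx ↦ ?_
  · rw [slackBlock, fromBlocks_transpose, hD, hM, transpose_one]
  · have h1 := quadForm_pos h hx
    rw [← Sum.elim_comp_inl_inr x, quadForm_slackBlock] at h1 ⊢
    have := rowTerm_le_rowTerm_inv_mul hX Y Hᵀ (x ∘ Sum.inr)
    linarith

/-- If `HHi = 1`, the slack constraint says that `X ≤ HᵀDH`. -/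
lemma quadForm_le_of_slackBlock_posDef {D H Hi Y X : Matrix (CL n nK) (CL n nK) ℝ} (hX : X.PosDef)
    (hH : H * Hi = 1) (h : (slackBlock D H Y X).PosDef) (ξ : CL n nK → ℝ) :
    ξ ⬝ᵥ (X *ᵥ ξ) ≤ (H *ᵥ ξ) ⬝ᵥ (D *ᵥ (H *ᵥ ξ)) := by
  have hc : X *ᵥ ξ = Hᵀ *ᵥ (Hiᵀ *ᵥ (X *ᵥ ξ)) := by
    rw [mulVec_mulVec, ← transpose_mul, mul_eq_one_comm.1 hH, transpose_one, one_mulVec]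
  -- The cross term of this vector is `-2 ξᵀXξ`, while the lower block contributes at most `ξᵀXξ`,
  -- by `rowTerm_le` with `c = ξ`.
  have h1 := quadForm_nonneg h (Sum.elim (-(H *ᵥ ξ)) (Hiᵀ *ᵥ (X *ᵥ ξ)))
  have h2 := rowTerm_le hX Y Hᵀ hc
  rw [quadForm_slackBlock] at h1
  simp only [neg_dotProduct, mulVec_neg, dotProduct_neg, mulVec_dotProduct H ξ (Hiᵀ *ᵥ _), ← hc] at h1
  linarith

lemma quadForm_congr (H : Matrix (Fin nZ) (EX n) ℝ) (D : Matrix (Fin nZ) (Fin nZ) ℝ)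
    (z : EX n → ℝ) : z ⬝ᵥ ((Hᵀ * D * H) *ᵥ z) = (H *ᵥ z) ⬝ᵥ (D *ᵥ (H *ᵥ z)) := by
  simp only [← mulVec_mulVec, mulVec_dotProduct H z]

lemma quadForm_dynBlock (H : Matrix (Fin nZ) (EX n) ℝ) (A : Matrix (CL n nK) (CL n nK) ℝ)
    (B : Matrix (CL n nK) (EX n) ℝ) (X2 X1 : Matrix (CL n nK) (CL n nK) ℝ)
    (D : Matrix (Fin nZ) (Fin nZ) ℝ) (ξ : CL n nK → ℝ) (z : EX n → ℝ) (p : CL n nK → ℝ) :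
    Sum.elim (Sum.elim ξ z) p ⬝ᵥ (dynBlock H A B X2 X1 D *ᵥ Sum.elim (Sum.elim ξ z) p) =
      ξ ⬝ᵥ (X2 *ᵥ ξ) + (H *ᵥ z) ⬝ᵥ (D *ᵥ (H *ᵥ z)) + 2 * (p ⬝ᵥ (A *ᵥ ξ + B *ᵥ z)) +
        p ⬝ᵥ (X1 *ᵥ p) := by
  simp only [dynBlock, fromBlocks_mulVec, Sum.elim_comp_inl, Sum.elim_comp_inr,
    sumElim_dotProduct_sumElim, dotProduct_add, fromRows_mulVec, fromCols_mulVec, zero_mulVec,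
    add_zero, zero_add, quadForm_congr, ← mulVec_dotProduct, dotProduct_comm _ p]
  ring

lemma posDef_of_dynBlock {H : Matrix (Fin nZ) (EX n) ℝ} {A : Matrix (CL n nK) (CL n nK) ℝ}
    {B : Matrix (CL n nK) (EX n) ℝ} {X2 X1 : Matrix (CL n nK) (CL n nK) ℝ}
    {D : Matrix (Fin nZ) (Fin nZ) ℝ} (h : (dynBlock H A B X2 X1 D).PosDef) :
    X2.PosDef ∧ X1.PosDef :=
  ⟨h.submatrix (e := Sum.inl ∘ Sum.inl) (Sum.inl_injective.comp Sum.inl_injective),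
    h.submatrix (e := Sum.inr) Sum.inr_injective⟩

/-- The one-step bound on the `j`-th row of the box. -/
lemma abs_row_le {HZ : Matrix (Fin nZ) (EX n) ℝ} {A : Matrix (CL n nK) (CL n nK) ℝ}
    {B : Matrix (CL n nK) (EX n) ℝ} {X2 X1 D1 H Hi Y1 Y2 : Matrix (CL n nK) (CL n nK) ℝ}
    {D2 : Matrix (Fin nZ) (Fin nZ) ℝ} {θ : ℝ} {j : CL n nK}
    (hD1 : D1.PosSemidef ∧ D1.IsDiag) (hD2 : D2.PosSemidef ∧ D2.IsDiag)
    (hdyn : (dynBlock HZ A B X2 X1 D2).PosDef) (hslack : (slackBlock D1 H Y2 X2).PosDef)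
    (hrow : (bordered (Y1ᵀ * Hi + Hiᵀ * Y1 - Y1ᵀ * X1 * Y1) (Pi.single j 1)
      (2 * θ - ones D1 - ones D2)).PosDef)
    (hH : H * Hi = 1) {ξ : CL n nK → ℝ} (hξ : ξ ∈ box H) {z : EX n → ℝ}
    (hz : -1 ≤ HZ *ᵥ z ∧ HZ *ᵥ z ≤ 1) :
    |(H *ᵥ (A *ᵥ ξ + B *ᵥ z)) j| ≤ θ := by
  obtain ⟨hX2, hX1⟩ := posDef_of_dynBlock hdyn
  have h1 := row_quadForm_le hX1 hH hrow
  have h2 := (quadForm_le_of_slackBlock_posDef hX2 hH hslack ξ).trans (quadForm_le_ones hD1 hξ)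
  have h3 := quadForm_le_ones hD2 hz
  -- The terms of the form other than the cross term sum to at most `2θ` by `h1`, `h2` and `h3`; the
  -- two signs of `H j` bound the cross term from both sides.
  have h4 := quadForm_nonneg hdyn (Sum.elim (Sum.elim ξ z) (H j))
  have h5 := quadForm_nonneg hdyn (Sum.elim (Sum.elim ξ z) (-H j))
  rw [quadForm_dynBlock] at h4 h5
  simp only [neg_dotProduct, mulVec_neg, dotProduct_neg] at h5
  change |H j ⬝ᵥ (A *ᵥ ξ + B *ᵥ z)| ≤ θ
  rw [abs_le]
  constructor <;> linarith

lemma smul_mem_box {H : Matrix (CL n nK) (CL n nK) ℝ} {x : CL n nK → ℝ} {θ : ℝ} (hθ : 0 < θ)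
    (h : ∀ j, |(H *ᵥ x) j| ≤ θ) : x ∈ θ • box H := by
  rw [Set.mem_smul_set_iff_inv_smul_mem₀ hθ.ne']
  constructor <;> intro j <;> have := abs_le.1 (h j) <;>
    simp only [mulVec_smul, Pi.smul_apply, smul_eq_mul, Pi.neg_apply, Pi.one_apply]
  · rw [← div_eq_inv_mul, le_div_iff₀ hθ]; linarith
  · rw [← div_eq_inv_mul, div_le_iff₀ hθ]; linarith

/-- The bound on the rows of a matrix `F` acting on the plant state over the box of `H`. -/
lemma row_le_of_inclusion {k : ℕ} {F : Matrix (Fin k) (Fin n) ℝ}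
    {H Hi D : Matrix (CL n nK) (CL n nK) ℝ} {q : Fin k} {r : ℝ}
    (hD : D.PosSemidef ∧ D.IsDiag) (hH : H * Hi = 1)
    (h : (bordered D ((fromCols F (0 : Matrix (Fin k) (Fin nK) ℝ) * Hi)ᵀ *ᵥ Pi.single q 1)
      (2 * r - ones D)).PosDef) {ξ : CL n nK → ℝ} (hξ : ξ ∈ box H) :
    (F *ᵥ (ξ ∘ Sum.inl)) q ≤ r := by
  -- Here `y = Hξ`, and `Hi * H = 1` turns its product with the border vector back into a row of `F`
  -- applied to the plant state.
  have h1 := dotProduct_le_of_bordered_posDef hD h hξ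
  rwa [← mulVec_dotProduct, ← mulVec_mulVec, mulVec_mulVec _ Hi H, mul_eq_one_comm.1 hH,
    one_mulVec, fromCols_mulVec, zero_mulVec, add_zero, dotProduct_single, mul_one] at h1

end Blocks

/-! ### Feasibility, invertibility and correctness for the programs. -/

section Programs

variable {n m nK nS nX nU nZ nc : ℕ} {d : Data n m nS nX nU nZ nc} {Y : Slack n nK nU}
  {v : Vars n m nK nS nX nU nZ}

lemma Constraints.XU_posDef (h : Constraints d Y v) (l : Fin nU) : (v.XU l).PosDef :=
  (posDef_of_bordered (h.inclU l)).submatrix (e := Sum.inl) Sum.inl_injective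

/-- A feasible point stays feasible when the slack matrices are updated from it. -/
lemma Constraints.nextSlack (h : Constraints d Y v) : Constraints d (nextSlack v) v where
  __ := h
  slackI j := slackBlock_inv_mul_posDef (posDef_of_dynBlock (h.dynI j)).1 (h.slackI j)
  slackO j := slackBlock_inv_mul_posDef (posDef_of_dynBlock (h.dynO j)).1 (h.slackO j)
  rowI j := bordered_rowTerm_inv_mul_posDef (posDef_of_dynBlock (h.dynI j)).2 (h.rowI j)
  rowO j := bordered_rowTerm_inv_mul_posDef (posDef_of_dynBlock (h.dynO j)).2 (h.rowO j)
  slackU l := slackBlock_inv_mul_posDef (h.XU_posDef l) (h.slackU l)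

lemma Constraints.isUnit (h : Constraints d Y v) :
    IsUnit v.HI ∧ IsUnit v.HIi ∧ IsUnit v.HO ∧ IsUnit v.HOi := by
  -- Without an index `j` the block constraints indexed by `j` are vacuous, but then all the
  -- matrices are `0 × 0` and trivially invertible.
  cases isEmpty_or_nonempty (CL n nK) with
  | inl _ => exact ⟨isUnit_of_subsingleton _, isUnit_of_subsingleton _,
      isUnit_of_subsingleton _, isUnit_of_subsingleton _⟩
  | inr hne =>
    obtain ⟨j⟩ := hne
    have hI := posDef_of_dynBlock (h.dynI j)
    have hO := posDef_of_dynBlock (h.dynO j)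
    exact ⟨isUnit_of_slackBlock_posDef hI.1 (h.slackI j),
      isUnit_of_rowTerm_posDef hI.2 (posDef_of_bordered (h.rowI j)),
      isUnit_of_slackBlock_posDef hO.1 (h.slackO j),
      isUnit_of_rowTerm_posDef hO.2 (posDef_of_bordered (h.rowO j))⟩

lemma trace_mul_transpose_nonneg {ι κ : Type} [Fintype ι] [Fintype κ] (M : Matrix ι κ ℝ) :
    0 ≤ (M * Mᵀ).trace := by
  simp only [trace, diag_apply, mul_apply, transpose_apply]
  exact Finset.sum_nonneg fun i _ ↦ Finset.sum_nonneg fun j _ ↦ mul_self_nonneg _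

lemma gap_nonneg (v : Vars n m nK nS nX nU nZ) : 0 ≤ gap v := trace_mul_transpose_nonneg _

lemma cost_nonneg (k : ℕ) (v : Vars n m nK nS nX nU nZ) : 0 ≤ cost k v := by
  unfold cost
  split_ifs
  exacts [trace_mul_transpose_nonneg _, gap_nonneg v]

lemma mul_eq_one_of_gap_eq_zero (h : gap v = 0) : v.HI * v.HIi = 1 ∧ v.HO * v.HOi = 1 := by
  have hG : G v = 0 := by
    rw [gap, ← conjTranspose_eq_transpose_of_trivial] at h
    exact trace_mul_conjTranspose_self_eq_zero_iff.1 h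
  rw [G, ← fromCols_zero, fromCols_inj.eq_iff] at hG
  simpa [sub_eq_zero] using hG

/-- Whatever the parity, the lock compares the point with itself and vanishes;
`Constraints.nextSlack` gives the rest. -/
lemma Feasible.succ {Y0 : Slack n nK nU} {sol : ℕ → Vars n m nK nS nX nU nZ} {k : ℕ}
    (h : Feasible d Y0 sol k (sol k)) : Feasible d Y0 sol (k + 1) (sol k) := by
  refine ⟨h.1.nextSlack, ?_⟩
  simp only [lockAt, sub_self, fromCols_zero, ite_self]

/-- The costs are bounded below, so some feasible cost lies within `t` of the infimum. The
constraints are strict, so attainment is not claimed. -/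
lemma exists_isOptimizerUpTo {Y0 : Slack n nK nU} {sol : ℕ → Vars n m nK nS nX nU nZ} {k : ℕ}
    (h : ∃ v, Feasible d Y0 sol k v) {t : ℝ} (ht : 0 < t) :
    ∃ v, IsOptimizerUpTo d Y0 sol k t v := by
  have hne : (cost k '' {v | Feasible d Y0 sol k v}).Nonempty := Set.Nonempty.image _ h
  have hbdd : BddBelow (cost k '' {v | Feasible d Y0 sol k v}) :=
    ⟨0, by rintro _ ⟨v, -, rfl⟩; exact cost_nonneg k v⟩
  obtain ⟨_, ⟨v, hv, rfl⟩, hlt⟩ := Real.lt_sInf_add_pos hne ht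
  exact ⟨v, hv, fun w hw ↦ by linarith [csInf_le hbdd (Set.mem_image_of_mem (cost k) hw)]⟩

lemma Constraints.innerConditions (hd : d.Admissible) (h : Constraints d Y v)
    (hH : v.HI * v.HIi = 1) : InnerConditions d v (box v.HI) where
  C1 := by
    rintro _ ⟨_, ⟨ξ, hξ, rfl⟩, _, ⟨z, hz, rfl⟩, rfl⟩
    exact smul_mem_box hd.η_mem.1 fun j ↦ abs_row_le (h.diagI1 j) (h.diagI2 j) (h.dynI j)
      (h.slackI j) (h.rowI j) hH hξ (hd.repZ hz)
  C2 := by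
    rintro _ ⟨ξ, hξ, rfl⟩
    have hpos : 0 < d.εs - d.εp - d.εm := by linarith [hd.εs_gt]
    rw [Set.mem_smul_set_iff_inv_smul_mem₀ hpos.ne', hd.repS]
    intro q
    have := row_le_of_inclusion (h.diagS q) hH (h.inclS q) hξ
    simp only [mulVec_smul, Pi.smul_apply, smul_eq_mul, Pi.one_apply]
    rw [← div_eq_inv_mul, div_le_iff₀ hpos]
    linarith

lemma Constraints.outerConditions (hd : d.Admissible) (h : Constraints d Y v)
    (hH : v.HO * v.HOi = 1) : OuterConditions d v (box v.HO) where
  O1 := by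
    rintro ξ ⟨hξ, hξ'⟩
    rw [hd.repSc] at hξ
    obtain ⟨α, hα, hsum, hx⟩ := hξ
    have hcomb : v.HO *ᵥ ξ = ∑ i, α i • (v.HO *ᵥ Sum.elim (d.ω i) 0) := by
      rw [← Sum.elim_comp_inl_inr ξ, hx, hξ']
      simp only [← mulVec_smul, ← mulVec_sum]
      congr 1
      ext (a | a) <;> simp
    constructor <;> intro j <;> rw [hcomb] <;>
      simp only [Finset.sum_apply, Pi.smul_apply, smul_eq_mul, Pi.neg_apply, Pi.one_apply]
    · calc -1 = ∑ i, α i * (-1) := by rw [← Finset.sum_mul, ← hsum]; ring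
        _ ≤ _ := Finset.sum_le_sum fun i _ ↦
          mul_le_mul_of_nonneg_left ((h.vertices i).1 j) (hα i)
    · calc _ ≤ ∑ i, α i * 1 := Finset.sum_le_sum fun i _ ↦
            mul_le_mul_of_nonneg_left ((h.vertices i).2 j) (hα i)
        _ = 1 := by rw [← Finset.sum_mul, ← hsum]; ring
  O2 := by
    rintro _ ⟨_, ⟨ξ, hξ, rfl⟩, _, ⟨z, hz, rfl⟩, rfl⟩
    rw [← one_smul ℝ (box v.HO)]
    exact smul_mem_box one_pos fun j ↦ abs_row_le (h.diagO1 j) (h.diagO2 j) (h.dynO j)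
      (h.slackO j) (by simpa using h.rowO j) hH hξ (hd.repZ hz)
  O3 := by
    rintro _ ⟨ξ, hξ, rfl⟩
    rw [hd.repX]
    exact fun p ↦ row_le_of_inclusion (h.diagX p) hH (by simpa using h.inclX p) hξ
  O4 := by
    rintro _ ⟨_, ⟨ξ, hξ, rfl⟩, _, ⟨z, hz, rfl⟩, rfl⟩
    rw [hd.repU]
    intro l
    have h1 := (quadForm_le_of_slackBlock_posDef (h.XU_posDef l) hH (h.slackU l) ξ).trans
      (quadForm_le_ones (h.diagU1 l) hξ)
    have h2 := quadForm_le_ones (h.diagU2 l) (hd.repZ hz)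
    -- The last entry `-1` puts minus twice the `l`-th input row into the form; `h1` and `h2` cancel
    -- the two sums in the corner, leaving the bound `1`.
    have h3 := quadForm_nonneg (h.inclU l) (Sum.elim (Sum.elim ξ z) fun _ ↦ -1)
    rw [quadForm_bordered] at h3
    simp only [fromBlocks_mulVec, Sum.elim_comp_inl, Sum.elim_comp_inr, zero_mulVec, add_zero,
      zero_add, sumElim_dotProduct_sumElim, ← mulVec_dotProduct,
      dotProduct_single, mul_one, ← mulVec_mulVec] at h3
    simp only [mulVec_add, Pi.add_apply, Pi.one_apply]
    linarith

end Programs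

/-! ### Real sequences that decrease up to summable errors, and the stopping test. -/

section Convergence

variable {u τ : ℕ → ℝ}

/-- A sequence bounded below that increases by at most `τ` in each step, with `τ` summable,
converges. -/
lemma exists_tendsto_of_le_add (h0 : ∀ k, 0 ≤ u k) (hτ : ∀ k, 0 ≤ τ k)
    (h : ∀ k, u (k + 1) ≤ u k + τ (k + 1)) (hs : Summable τ) :
    ∃ L : ℝ, 0 ≤ L ∧ Tendsto u atTop (𝓝 L) := by
  -- Subtracting the accumulated tolerances restores monotonicity. The range is `k + 1` because the
  -- step to `u (k + 1)` costs `τ (k + 1)`.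
  have hanti : Antitone fun k ↦ u k - ∑ i ∈ Finset.range (k + 1), τ i :=
    antitone_nat_of_succ_le fun k ↦ by
      rw [Finset.sum_range_succ _ (k + 1)]
      linarith [h k]
  have hbdd : BddBelow (Set.range fun k ↦ u k - ∑ i ∈ Finset.range (k + 1), τ i) := by
    refine ⟨-∑' i, τ i, ?_⟩
    rintro _ ⟨k, rfl⟩
    have := hs.sum_le_tsum (Finset.range (k + 1)) fun i _ ↦ hτ i
    dsimp only
    linarith [h0 k]
  have hlim := (tendsto_atTop_ciInf hanti hbdd).add
    ((tendsto_add_atTop_iff_nat 1).2 hs.hasSum.tendsto_sum_nat)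
  simp only [sub_add_cancel] at hlim
  exact ⟨_, ge_of_tendsto' hlim h0, hlim⟩

/-- If every step decreased `u` by at least `ε`, then `u` would become negative. Neither
monotonicity nor convergence is needed. -/
lemma exists_sub_lt (h0 : ∀ k, 0 ≤ u k) {ε : ℝ} (hε : 0 < ε) :
    ∃ k, 1 ≤ k ∧ ¬ (u (k - 1) - u k ≥ ε) := by
  by_contra! hcon
  have hdec : ∀ k : ℕ, u k ≤ u 0 - k * ε := fun k ↦ by
    induction k with
    | zero => simp
    | succ k ih =>
      have := hcon (k + 1) (by omega)
      simp only [Nat.add_sub_cancel] at this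
      push_cast
      linarith
  obtain ⟨k, hk⟩ := exists_nat_gt (u 0 / ε)
  rw [div_lt_iff₀ hε] at hk
  linarith [hdec k, h0 k]

end Convergence

end HandsOff

theorem theorem3 {n m nK nS nX nU nZ nc : ℕ}
    (d : HandsOff.Data n m nS nX nU nZ nc) (hd : d.Admissible)
    (Y0 : HandsOff.Slack n nK nU) (hY0 : Y0.Invertible)
    (sol : ℕ → HandsOff.Vars n m nK nS nX nU nZ)
    (h0 : ∃ v, HandsOff.Feasible d Y0 sol 0 v)
    (τ : ℕ → ℝ) (hτ : ∀ k, 0 ≤ τ k) :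
    -- statements on the `k`-th program, the earlier ones being solved by `sol 0, …, sol (k - 1)`
    (∀ k : ℕ, (∀ i < k, HandsOff.IsOptimizerUpTo d Y0 sol i (τ i) (sol i)) →
      -- (a) recursive feasibility
      ((∃ v, HandsOff.Feasible d Y0 sol k v) ∧
        (0 < τ k → ∃ v, HandsOff.IsOptimizerUpTo d Y0 sol k (τ k) v)) ∧
      ∀ v, HandsOff.Feasible d Y0 sol k v →
        -- (b) invertibility
        (IsUnit v.HI ∧ IsUnit v.HIi ∧ IsUnit v.HO ∧ IsUnit v.HOi) ∧
        -- (c) correctness of the design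
        (HandsOff.gap v = 0 →
          HandsOff.InnerConditions d v (HandsOff.box v.HI) ∧
          HandsOff.OuterConditions d v (HandsOff.box v.HO))) ∧
    -- (a) convergence: the stopping test is met, and the costs converge
    ((∀ i, HandsOff.IsOptimizerUpTo d Y0 sol i (τ i) (sol i)) →
      (∃ k, 1 ≤ k ∧ ¬ (HandsOff.gap (sol (k - 1)) - HandsOff.gap (sol k) ≥ d.εc)) ∧
      (∀ k, HandsOff.gap (sol (k + 1)) ≤ HandsOff.gap (sol k) + τ (k + 1)) ∧
      (Summable τ → ∃ L : ℝ, 0 ≤ L ∧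
        Tendsto (fun k => HandsOff.gap (sol k)) atTop (𝓝 L))) := by
  have hgap : ∀ k, 0 ≤ HandsOff.gap (sol k) := fun k ↦ HandsOff.gap_nonneg _
  refine ⟨fun k hk ↦ ?_, fun hsol ↦ ?_⟩
  · have hfeas : ∃ v, HandsOff.Feasible d Y0 sol k v := by
      cases k with
      | zero => exact h0
      | succ k => exact ⟨sol k, (hk k k.lt_succ_self).1.succ⟩
    refine ⟨⟨hfeas, HandsOff.exists_isOptimizerUpTo hfeas⟩, fun v hv ↦ ⟨hv.1.isUnit, fun h ↦ ?_⟩⟩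
    obtain ⟨hI, hO⟩ := HandsOff.mul_eq_one_of_gap_eq_zero h
    exact ⟨hv.1.innerConditions hd hI, hv.1.outerConditions hd hO⟩
  · have hstep : ∀ k, HandsOff.gap (sol (k + 1)) ≤ HandsOff.gap (sol k) + τ (k + 1) := fun k ↦ by
      -- The preceding solution is the competitor, and from index `1` on the cost is the gap itself.
      simpa [HandsOff.cost] using (hsol (k + 1)).2 (sol k) (hsol k).1.succ
    exact ⟨HandsOff.exists_sub_lt hgap hd.εc_pos, hstep,
      HandsOff.exists_tendsto_of_le_add hgap hτ hstep⟩
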